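/- **Proposition.** Let $\lambda\in\mathbb{C}\setminus\{0,1\}$, let $\mathcal{E}$ be the complex elliptic curve $y^2=x(x-1)(x-\lambda)$ (together with its point at infinity), and let $f:\mathcal{E}\to\mathcal{E}$ be a morphism of degree $D\ge 1$ which fixes the point at infinity. Let $x:\mathcal{E}\to\mathbb{CP}^1$ be the two-fold cover $(x,y)\mapsto x$, sending the point at infinity to $\infty$. Then there is a unique rational function $h\in\mathbb{C}(x)$, viewed as a map $h:\mathbb{CP}^1\to\mathbb{CP}^1$, such that $x\circ f=h\circ x$. This $h$ has degree $D$ and satisfies: * $h(\infty)=\infty$; * the multiplicity (local degree) of $h$ at each of its critical points is $2$, and $h$ has exactly $2D-2$ critical points; * the critical values of $h$ belong to $\{0,1,\lambda,\infty\}$; * each of the points $0,1,\lambda,\infty$ is a simple point of $h$ (a point of multiplicity $1$), and $h$ maps it into $\{0,1,\lambda,\infty\}$. -/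

import Mathlib

noncomputable section

namespace Legendre

/-- The Legendre curve `y² = x(x-1)(x-lam) = x³ - (1+lam)x² + lam x` over the complex numbers. -/
def curve (lam : ℂ) : WeierstrassCurve.Affine ℂ :=
  { a₁ := 0, a₂ := -(1 + lam), a₃ := 0, a₄ := lam, a₆ := 0 }

/-- The complex points of the projective Legendre curve (the affine points together with the
point at infinity `0`). -/
abbrev Curve (lam : ℂ) : Type := (curve lam).Point

/-- Homogeneous coordinates `[X : Y : Z]` in the projective plane of a point of the curve; the
point at infinity is `[0 : 1 : 0]` and an affine point `(x, y)` is `[x : y : 1]`. -/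
def coords {lam : ℂ} : Curve lam → Fin 3 → ℂ
  | .zero => ![0, 1, 0]
  | .some x y _ => ![x, y, 1]

/-- The two-fold cover `(x, y) ↦ x` of the Riemann sphere by the curve; it sends the point at
infinity to `∞`. -/
def xMap {lam : ℂ} : Curve lam → OnePoint ℂ
  | .zero => OnePoint.infty
  | .some x _ _ => (x : OnePoint ℂ)

/-- `f` is a morphism of projective curves: around each point `P` it is given by
`[F₀ : F₁ : F₂]` for homogeneous polynomials `F₀, F₁, F₂` of the same degree which do not all vanish
at `P`, the formula being valid at all points of the curve at which they do not all vanish. -/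
def IsMorphism {lam : ℂ} (f : Curve lam → Curve lam) : Prop :=
  ∀ P : Curve lam, ∃ (n : ℕ) (F : Fin 3 → MvPolynomial (Fin 3) ℂ),
    (∀ i, (F i).IsHomogeneous n) ∧
    (∃ i, MvPolynomial.eval (coords P) (F i) ≠ 0) ∧
    ∀ Q : Curve lam, (∃ i, MvPolynomial.eval (coords Q) (F i) ≠ 0) →
      ∃ c : ℂ, c ≠ 0 ∧ ∀ i, MvPolynomial.eval (coords Q) (F i) = c * coords (f Q) i

/-- `f` has degree `D`: all but finitely many fibres of `f` consist of exactly `D` points. -/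
def HasDegree {lam : ℂ} (f : Curve lam → Curve lam) (D : ℕ) : Prop :=
  {Q : Curve lam | (f ⁻¹' {Q}).encard ≠ (D : ℕ∞)}.Finite

/-- The degree of a rational function `P/Q` in lowest terms, `max (deg P) (deg Q)`. -/
def degree (h : RatFunc ℂ) : ℕ := max h.num.natDegree h.denom.natDegree

open Classical in
/-- A rational function as a self-map of the Riemann sphere. Writing `h = P/Q` in lowest terms
and `d = degree h`, the value at infinity is the ratio of the coefficients of `x ^ d` in `P`
and `Q`. -/
def value (h : RatFunc ℂ) : OnePoint ℂ → OnePoint ℂ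
  | .infty =>
      if h.denom.coeff (degree h) = 0 then OnePoint.infty
      else ((h.num.coeff (degree h) / h.denom.coeff (degree h) : ℂ) : OnePoint ℂ)
  | .some z =>
      if h.denom.eval z = 0 then OnePoint.infty
      else ((h.num.eval z / h.denom.eval z : ℂ) : OnePoint ℂ)

/-- With `h = P/Q` in lowest terms, the polynomial whose zeros in `ℂ` are the points of the fibre
of `h` over `w`: it is `P - w Q` for finite `w`, and `Q` for `w = ∞`. -/
def fibrePoly (h : RatFunc ℂ) : OnePoint ℂ → Polynomial ℂ
  | .infty => h.denom
  | .some w => h.num - Polynomial.C w * h.denom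

/-- The multiplicity (local degree) at a point of the sphere of a nonconstant rational function
`h`: the order of vanishing there of `h - h(p)`, or of `1/h` if `h(p) = ∞`, in the local
coordinate `x - p` if `p` is finite and `1/x` if `p = ∞`. -/
def multiplicity (h : RatFunc ℂ) (p : OnePoint ℂ) : ℕ :=
  match p with
  | .infty => degree h - (fibrePoly h (value h OnePoint.infty)).natDegree
  | .some z => (fibrePoly h (value h (z : OnePoint ℂ))).rootMultiplicity z

/-- A critical point is a point at which the multiplicity is larger than one. -/
def IsCriticalPoint (h : RatFunc ℂ) (p : OnePoint ℂ) : Prop := 1 < multiplicity h p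

/-- A simple point is a point at which the multiplicity is one. -/
def IsSimplePoint (h : RatFunc ℂ) (p : OnePoint ℂ) : Prop := multiplicity h p = 1

/-- A critical value is the value at a critical point. -/
def IsCriticalValue (h : RatFunc ℂ) (w : OnePoint ℂ) : Prop :=
  ∃ p, IsCriticalPoint h p ∧ value h p = w

/-- The four points `0, 1, lam, ∞` of the sphere. -/
def fourPoints (lam : ℂ) : Set (OnePoint ℂ) :=
  {((0 : ℂ) : OnePoint ℂ), ((1 : ℂ) : OnePoint ℂ), (lam : OnePoint ℂ), OnePoint.infty}

/-- `h` is induced by `f` on the sphere: `x ∘ f = h ∘ x`. -/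
def Induces {lam : ℂ} (f : Curve lam → Curve lam) (h : RatFunc ℂ) : Prop :=
  ∀ P : Curve lam, xMap (f P) = value h (xMap P)

end Legendre

end

open Polynomial Filter

noncomputable section

namespace Legendre

/-- The cubic polynomial `x(x-1)(x-lam)`. -/
def cubic (lam : ℂ) : ℂ[X] := X * (X - 1) * (X - C lam)

/-- The binary quartic form whose zeros are `0, 1, lam, ∞`, evaluated at `[P : Q]`. -/
def branchForm (lam : ℂ) (P Q : ℂ[X]) : ℂ[X] := P * (P - Q) * (P - C lam * Q) * Q

theorem rootMultiplicity_wronskian_add_one {S T : ℂ[X]} {z : ℂ} (hS0 : S ≠ 0)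
    (hS : S.eval z = 0) (hT : T.eval z ≠ 0) :
    (wronskian S T).rootMultiplicity z + 1 = S.rootMultiplicity z := by
  obtain ⟨R, hR, hRz⟩ := exists_eq_pow_rootMultiplicity_mul_and_not_dvd S hS0 z
  have hpos : 0 < S.rootMultiplicity z := (rootMultiplicity_pos hS0).2 hS
  obtain ⟨k, hk⟩ : ∃ k, S.rootMultiplicity z = k + 1 := ⟨_, (Nat.succ_pred_eq_of_pos hpos).symm⟩
  rw [hk] at hR ⊢
  set B : ℂ[X] := (X - C z) * (R * derivative T - derivative R * T) - C ((k : ℂ) + 1) * R * T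
    with hB
  have hW : wronskian S T = (X - C z) ^ k * B := by
    have hd : derivative ((X - C z) ^ (k + 1)) = C ((k : ℂ) + 1) * (X - C z) ^ k := by
      rw [derivative_X_sub_C_pow]
      simp
    rw [wronskian, hR, hB, derivative_mul, hd]
    ring
  have hBz : B.eval z ≠ 0 := by
    have hRz' : R.eval z ≠ 0 := fun h => hRz (dvd_iff_isRoot.2 h)
    have hk0 : (k : ℂ) + 1 ≠ 0 := by exact_mod_cast Nat.succ_ne_zero k
    simp [hB, hRz', hT, hk0]
  have hB0 : B ≠ 0 := fun h => hBz (by simp [h])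
  rw [hW, rootMultiplicity_mul (mul_ne_zero (pow_ne_zero _ (X_sub_C_ne_zero z)) hB0),
    rootMultiplicity_X_sub_C_pow, rootMultiplicity_eq_zero hBz]

theorem wronskian_sub_C_mul_left (P Q : ℂ[X]) (w : ℂ) :
    wronskian (P - C w * Q) Q = wronskian P Q := by
  simp only [wronskian, derivative_sub, derivative_C_mul]
  ring

theorem sub_C_mul_ne_zero {P Q : ℂ[X]} (hW : wronskian P Q ≠ 0) (w : ℂ) : P - C w * Q ≠ 0 := by
  intro h
  rw [← wronskian_sub_C_mul_left P Q w, h] at hW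
  simp at hW

theorem right_ne_zero_of_wronskian {P Q : ℂ[X]} (hW : wronskian P Q ≠ 0) : Q ≠ 0 := by
  rintro rfl
  simp at hW

theorem eval_ne_zero_of_isCoprime {P Q : ℂ[X]} (h : IsCoprime P Q) {z : ℂ} (hQ : Q.eval z = 0) :
    P.eval z ≠ 0 := by
  intro hP
  obtain ⟨a, b, hab⟩ := h
  have := congrArg (eval z) hab
  simp [hP, hQ] at this

/-- The multiplicity of `P/Q` at a finite point which is not a pole, through the Wronskian. -/
theorem rootMultiplicity_sub_C_mul {P Q : ℂ[X]} (hW : wronskian P Q ≠ 0) {z w : ℂ}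
    (hQ : Q.eval z ≠ 0) (hw : (P - C w * Q).eval z = 0) :
    (P - C w * Q).rootMultiplicity z = (wronskian P Q).rootMultiplicity z + 1 := by
  rw [← rootMultiplicity_wronskian_add_one (sub_C_mul_ne_zero hW w) hw hQ,
    wronskian_sub_C_mul_left]

/-- The multiplicity of `P/Q` at a finite pole, through the Wronskian. -/
theorem rootMultiplicity_denom {P Q : ℂ[X]} (hW : wronskian P Q ≠ 0) (h : IsCoprime P Q) {z : ℂ}
    (hQ : Q.eval z = 0) :
    Q.rootMultiplicity z = (wronskian P Q).rootMultiplicity z + 1 := by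
  rw [← rootMultiplicity_wronskian_add_one (right_ne_zero_of_wronskian hW) hQ
    (eval_ne_zero_of_isCoprime h hQ), ← wronskian_neg_eq, ← neg_one_mul, ← C_1, ← C_neg,
    rootMultiplicity_mul (by simpa using hW), rootMultiplicity_C, zero_add]

theorem branchForm_eq (lam : ℂ) (P Q : ℂ[X]) :
    branchForm lam P Q = (P - C 0 * Q) * (P - C 1 * Q) * (P - C lam * Q) * Q := by
  simp [branchForm]

theorem branchForm_ne_zero (lam : ℂ) {P Q : ℂ[X]} (hW : wronskian P Q ≠ 0) :
    branchForm lam P Q ≠ 0 := by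
  rw [branchForm_eq]
  exact mul_ne_zero (mul_ne_zero (mul_ne_zero (sub_C_mul_ne_zero hW _) (sub_C_mul_ne_zero hW _))
    (sub_C_mul_ne_zero hW _)) (right_ne_zero_of_wronskian hW)

theorem rootMultiplicity_branchForm {lam : ℂ} (h0 : lam ≠ 0) (h1 : lam ≠ 1) {P Q : ℂ[X]}
    (h : IsCoprime P Q) (hW : wronskian P Q ≠ 0) {z : ℂ} (hz : (branchForm lam P Q).eval z = 0) :
    (branchForm lam P Q).rootMultiplicity z = (wronskian P Q).rootMultiplicity z + 1 := by
  have hne := branchForm_ne_zero lam hW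
  rw [branchForm_eq] at hz hne ⊢
  rw [rootMultiplicity_mul hne, rootMultiplicity_mul (left_ne_zero_of_mul hne),
    rootMultiplicity_mul (left_ne_zero_of_mul (left_ne_zero_of_mul hne))]
  by_cases hQ : Q.eval z = 0
  · have hP := eval_ne_zero_of_isCoprime h hQ
    have key (w : ℂ) : (P - C w * Q).rootMultiplicity z = 0 :=
      rootMultiplicity_eq_zero (by simp [hQ, hP])
    rw [key, key, key, rootMultiplicity_denom hW h hQ]
    ring
  · have key (w w' : ℂ) (hne : w ≠ w') (hw : (P - C w * Q).eval z = 0) :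
        (P - C w' * Q).rootMultiplicity z = 0 := by
      refine rootMultiplicity_eq_zero fun hw' => ?_
      simp only [IsRoot.def, eval_sub, eval_mul, eval_C] at hw hw'
      have : (w - w') * Q.eval z = 0 := by linear_combination hw' - hw
      rcases mul_eq_zero.1 this with h | h
      exacts [hne (sub_eq_zero.1 h), hQ h]
    rw [rootMultiplicity_eq_zero (p := Q) hQ]
    rw [eval_mul, mul_eq_zero, or_iff_left hQ, eval_mul, mul_eq_zero, eval_mul, mul_eq_zero] at hz
    rcases hz with (hz | hz) | hz
    · rw [rootMultiplicity_sub_C_mul hW hQ hz, key 0 1 zero_ne_one hz, key 0 lam h0.symm hz]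
    · rw [rootMultiplicity_sub_C_mul hW hQ hz, key 1 0 one_ne_zero hz, key 1 lam h1.symm hz]
      ring
    · rw [rootMultiplicity_sub_C_mul hW hQ hz, key lam 0 h0 hz, key lam 1 h1 hz]
      ring

theorem dvd_wronskian_mul {lam : ℂ} (h0 : lam ≠ 0) (h1 : lam ≠ 1) {P Q c T : ℂ[X]}
    (h : IsCoprime P Q) (hW : wronskian P Q ≠ 0) (hc0 : c ≠ 0)
    (hc : ∀ z, c.rootMultiplicity z ≤ 1) (hT : branchForm lam P Q * c = T ^ 2) :
    T ∣ wronskian P Q * c := by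
  have hne := mul_ne_zero (branchForm_ne_zero lam hW) hc0
  have hT0 : T ≠ 0 := by
    rintro rfl
    exact hne (by simpa using hT)
  rw [IsAlgClosed.dvd_iff_roots_le_roots hT0 (mul_ne_zero hW hc0), Multiset.le_iff_count]
  intro z
  rw [count_roots, count_roots, rootMultiplicity_mul (mul_ne_zero hW hc0)]
  have e := congrArg (rootMultiplicity z) hT
  rw [rootMultiplicity_mul hne, sq, rootMultiplicity_mul (mul_ne_zero hT0 hT0)] at e
  have := hc z
  by_cases hz : (branchForm lam P Q).eval z = 0
  · rw [rootMultiplicity_branchForm h0 h1 h hW hz] at e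
    omega
  · rw [rootMultiplicity_eq_zero hz] at e
    omega

theorem natDegree_branchForm (lam : ℂ) {P Q : ℂ[X]} (hW : wronskian P Q ≠ 0) :
    (branchForm lam P Q).natDegree = P.natDegree + (P - Q).natDegree +
      (P - C lam * Q).natDegree + Q.natDegree := by
  have hP := sub_C_mul_ne_zero hW 0
  have h1 := sub_C_mul_ne_zero hW 1
  have hl := sub_C_mul_ne_zero hW lam
  have hQ := right_ne_zero_of_wronskian hW
  simp only [C_0, zero_mul, sub_zero, C_1, one_mul] at hP h1
  rw [branchForm, natDegree_mul (by simp_all) hQ, natDegree_mul (by simp_all) hl,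
    natDegree_mul hP h1]

/-- The Legendre curve has no nonconstant rational parametrisation. -/
theorem derivative_eq_zero_of_branchForm_eq_sq {lam : ℂ} (h0 : lam ≠ 0) (h1 : lam ≠ 1)
    {P Q T : ℂ[X]} (h : IsCoprime P Q) (hT : branchForm lam P Q = T ^ 2) :
    derivative P = 0 ∧ derivative Q = 0 := by
  rw [← h.wronskian_eq_zero_iff]
  by_contra hW
  have hdvd : T ∣ wronskian P Q := by
    simpa using dvd_wronskian_mul h0 h1 h hW one_ne_zero (c := 1)
      (fun z => by rw [← C_1, rootMultiplicity_C]; exact zero_le_one) (by simpa using hT)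
  have hle := natDegree_le_of_dvd hdvd hW
  have hlt := natDegree_wronskian_lt_add hW
  have hW' : wronskian (P - Q) (P - C lam * Q) = C (1 - lam) * wronskian P Q := by
    simp only [wronskian, derivative_sub, derivative_C_mul, C_sub, C_1]
    ring
  have hl : (1 - lam) ≠ 0 := sub_ne_zero.2 h1.symm
  have hlt' := natDegree_wronskian_lt_add (a := P - Q) (b := P - C lam * Q)
    (by rw [hW']; exact mul_ne_zero (C_ne_zero.2 hl) hW)
  rw [hW', natDegree_C_mul hl] at hlt'
  have hd := congrArg natDegree hT
  rw [natDegree_branchForm lam hW, natDegree_pow] at hd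
  omega

theorem cubic_monic (lam : ℂ) : (cubic lam).Monic := by
  unfold cubic
  rw [← C_1]
  exact (monic_X.mul (monic_X_sub_C _)).mul (monic_X_sub_C _)

theorem natDegree_cubic (lam : ℂ) : (cubic lam).natDegree = 3 := by
  unfold cubic
  rw [← C_1, natDegree_mul (mul_ne_zero X_ne_zero (X_sub_C_ne_zero _)) (X_sub_C_ne_zero _),
    natDegree_mul X_ne_zero (X_sub_C_ne_zero _), natDegree_X, natDegree_X_sub_C, natDegree_X_sub_C]

theorem rootMultiplicity_cubic_le_one {lam : ℂ} (h0 : lam ≠ 0) (h1 : lam ≠ 1) (z : ℂ) :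
    (cubic lam).rootMultiplicity z ≤ 1 := by
  have hne := (cubic_monic lam).ne_zero
  have e : cubic lam = (X - C 0) * (X - C 1) * (X - C lam) := by simp [cubic]
  rw [e] at hne ⊢
  rw [rootMultiplicity_mul hne, rootMultiplicity_mul (left_ne_zero_of_mul hne)]
  simp only [rootMultiplicity_X_sub_C]
  split_ifs <;> simp_all

theorem eval_cubic (lam z : ℂ) : (cubic lam).eval z = z * (z - 1) * (z - lam) := by
  simp [cubic]

section Covering

variable {lam : ℂ} {P Q T : ℂ[X]}

theorem wronskian_ne_zero_of_natDegree_lt (h : IsCoprime P Q) (hdeg : Q.natDegree < P.natDegree) :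
    wronskian P Q ≠ 0 := by
  intro hW
  have := derivative_eq_zero.1 (h.wronskian_eq_zero_iff.1 hW).1
  omega

theorem natDegree_sub_C_mul (hdeg : Q.natDegree < P.natDegree) (w : ℂ) :
    (P - C w * Q).natDegree = P.natDegree :=
  natDegree_sub_eq_left_of_natDegree_lt ((natDegree_C_mul_le _ _).trans_lt hdeg)

/-- If `P/Q` lifts to the Legendre curve and fixes infinity, then it satisfies the differential
equation `h'² x(x-1)(x-lam) = k h(h-1)(h-lam)`. -/
theorem wronskian_sq_mul_cubic (h0 : lam ≠ 0) (h1 : lam ≠ 1) (h : IsCoprime P Q)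
    (hdeg : Q.natDegree < P.natDegree) (hT : branchForm lam P Q * cubic lam = T ^ 2) :
    P.natDegree = Q.natDegree + 1 ∧ (wronskian P Q).natDegree = 2 * P.natDegree - 2 ∧
      ∃ k : ℂ, k ≠ 0 ∧ wronskian P Q ^ 2 * cubic lam = C k * branchForm lam P Q := by
  have hW := wronskian_ne_zero_of_natDegree_lt h hdeg
  have hc0 := (cubic_monic lam).ne_zero
  have hB := branchForm_ne_zero lam hW
  have hWc := mul_ne_zero hW hc0
  have hdvd := dvd_wronskian_mul h0 h1 h hW hc0 (rootMultiplicity_cubic_le_one h0 h1) hT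
  have hle := natDegree_le_of_dvd hdvd hWc
  have hlt := natDegree_wronskian_lt_add hW
  have hd := congrArg natDegree hT
  have e1 : (P - Q).natDegree = P.natDegree := by simpa using natDegree_sub_C_mul hdeg 1
  rw [natDegree_pow, natDegree_mul hB hc0, natDegree_branchForm lam hW,
    natDegree_sub_C_mul hdeg, e1, natDegree_cubic] at hd
  rw [natDegree_mul hW hc0, natDegree_cubic] at hle
  refine ⟨by omega, by omega, ?_⟩
  obtain ⟨R, hR⟩ := hdvd
  have hR0 : R ≠ 0 := by
    rintro rfl
    exact hWc (by simpa using hR)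
  have hT0 : T ≠ 0 := by
    rintro rfl
    exact hWc (by simpa using hR)
  have hRd := congrArg natDegree hR
  rw [natDegree_mul hW hc0, natDegree_mul hT0 hR0, natDegree_cubic] at hRd
  obtain ⟨r, rfl⟩ := natDegree_eq_zero.1 (show R.natDegree = 0 by omega)
  refine ⟨r ^ 2, pow_ne_zero _ (C_ne_zero.1 hR0), mul_right_cancel₀ hc0 ?_⟩
  rw [C_pow]
  linear_combination (wronskian P Q * cubic lam + T * C r) * hR - C r ^ 2 * hT

theorem rootMultiplicity_wronskian_add_cubic (h0 : lam ≠ 0) (h1 : lam ≠ 1) (h : IsCoprime P Q)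
    (hW : wronskian P Q ≠ 0) {k : ℂ} (hk : k ≠ 0)
    (hkW : wronskian P Q ^ 2 * cubic lam = C k * branchForm lam P Q) {z : ℂ}
    (hz : (branchForm lam P Q).eval z = 0) :
    (wronskian P Q).rootMultiplicity z + (cubic lam).rootMultiplicity z = 1 := by
  have hc0 := (cubic_monic lam).ne_zero
  have e := congrArg (rootMultiplicity z) hkW
  rw [sq, rootMultiplicity_mul (mul_ne_zero (mul_ne_zero hW hW) hc0),
    rootMultiplicity_mul (mul_ne_zero hW hW),
    rootMultiplicity_mul (mul_ne_zero (C_ne_zero.2 hk) (branchForm_ne_zero lam hW)),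
    rootMultiplicity_C, rootMultiplicity_branchForm h0 h1 h hW hz] at e
  omega

theorem eval_branchForm_eq_zero {k : ℂ} (hk : k ≠ 0)
    (hkW : wronskian P Q ^ 2 * cubic lam = C k * branchForm lam P Q) {z : ℂ}
    (hz : (wronskian P Q).eval z = 0 ∨ (cubic lam).eval z = 0) :
    (branchForm lam P Q).eval z = 0 := by
  have e := congrArg (eval z) hkW
  rcases hz with hz | hz <;> simpa [hz, hk] using e

end Covering

theorem exists_eq_sq_of_algebraMap_eq_sq {p : ℂ[X]} {Z : RatFunc ℂ}
    (h : algebraMap ℂ[X] (RatFunc ℂ) p = Z ^ 2) : ∃ T : ℂ[X], p = T ^ 2 := by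
  obtain ⟨T, rfl⟩ := IsIntegrallyClosed.exists_algebraMap_eq_of_isIntegral_pow (R := ℂ[X]) two_pos
    (h ▸ isIntegral_algebraMap : IsIntegral ℂ[X] (Z ^ 2))
  refine ⟨T, RatFunc.algebraMap_injective ℂ ?_⟩
  rw [h, map_pow]

theorem algebraMap_denom_ne_zero (h : RatFunc ℂ) :
    algebraMap ℂ[X] (RatFunc ℂ) h.denom ≠ 0 :=
  RatFunc.algebraMap_ne_zero h.denom_ne_zero

theorem mul_algebraMap_denom (h : RatFunc ℂ) :
    h * algebraMap ℂ[X] (RatFunc ℂ) h.denom = algebraMap ℂ[X] (RatFunc ℂ) h.num := by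
  have := RatFunc.num_div_denom h
  rw [div_eq_iff (algebraMap_denom_ne_zero h)] at this
  exact this.symm

theorem algebraMap_branchForm (lam : ℂ) (h : RatFunc ℂ) :
    algebraMap ℂ[X] (RatFunc ℂ) (branchForm lam h.num h.denom) =
      h * (h - 1) * (h - RatFunc.C lam) * algebraMap ℂ[X] (RatFunc ℂ) h.denom ^ 4 := by
  simp only [branchForm, map_mul, map_sub, ← mul_algebraMap_denom, RatFunc.algebraMap_C]
  ring

theorem eq_C_of_sq_eq {lam : ℂ} (h0 : lam ≠ 0) (h1 : lam ≠ 1) {x y : RatFunc ℂ}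
    (hxy : y ^ 2 = x * (x - 1) * (x - RatFunc.C lam)) :
    ∃ a b : ℂ, x = RatFunc.C a ∧ y = RatFunc.C b := by
  obtain ⟨T, hT⟩ := exists_eq_sq_of_algebraMap_eq_sq (p := branchForm lam x.num x.denom)
    (Z := y * algebraMap ℂ[X] (RatFunc ℂ) x.denom ^ 2)
    (by rw [algebraMap_branchForm, ← hxy]; ring)
  obtain ⟨hn, hd⟩ := derivative_eq_zero_of_branchForm_eq_sq h0 h1 x.isCoprime_num_denom hT
  obtain ⟨a, ha⟩ := natDegree_eq_zero.1 (derivative_eq_zero.1 hn)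
  obtain ⟨d, hd⟩ := natDegree_eq_zero.1 (derivative_eq_zero.1 hd)
  have hx : x = RatFunc.C (a / d) := by
    rw [← RatFunc.num_div_denom x, ← ha, ← hd, RatFunc.algebraMap_C, RatFunc.algebraMap_C, map_div₀]
  obtain ⟨b, hb⟩ := IsAlgClosed.exists_pow_nat_eq ((a / d) * (a / d - 1) * (a / d - lam)) two_pos
  have hy : y ^ 2 = RatFunc.C b ^ 2 := by
    rw [hxy, hx, ← map_pow, hb]
    simp
  rcases sq_eq_sq_iff_eq_or_eq_neg.1 hy with hy | hy
  · exact ⟨_, b, hx, hy⟩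
  · exact ⟨_, -b, hx, by rw [hy, map_neg]⟩

/-- The image of the cubic polynomial in the field of rational functions. -/
abbrev cubicRat (lam : ℂ) : RatFunc ℂ := algebraMap ℂ[X] (RatFunc ℂ) (cubic lam)

/-- The function field `ℂ(x, y)` of the Legendre curve. -/
abbrev FunField (lam : ℂ) : Type := QuadraticAlgebra (RatFunc ℂ) (cubicRat lam) 0

open Classical in
/-- The valuation of `ℂ(x)` at infinity. -/
def ratVal : Valuation (RatFunc ℂ) (WithZero (Multiplicative ℤ)) := RatFunc.inftyValuation ℂ

theorem ratVal_algebraMap {p : ℂ[X]} (hp : p ≠ 0) :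
    ratVal (algebraMap ℂ[X] (RatFunc ℂ) p) = WithZero.exp (p.natDegree : ℤ) := by
  classical
  exact RatFunc.inftyValuation.polynomial ℂ hp

theorem ratVal_C {k : ℂ} (hk : k ≠ 0) : ratVal (RatFunc.C k) = 1 := by
  classical
  exact RatFunc.inftyValuation.C ℂ hk

theorem ratVal_cubicRat (lam : ℂ) : ratVal (cubicRat lam) = WithZero.exp 3 := by
  rw [ratVal_algebraMap (cubic_monic lam).ne_zero, natDegree_cubic]
  rfl

theorem ratVal_sq_ne (lam : ℂ) {a b : RatFunc ℂ} (hb : b ≠ 0) :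
    ratVal (a * a) ≠ ratVal (cubicRat lam * b * b) := by
  rw [map_mul, map_mul, map_mul, ratVal_cubicRat]
  have hb' := (ratVal.ne_zero_iff).2 hb
  rw [← WithZero.exp_log hb', ← WithZero.exp_add, ← WithZero.exp_add]
  by_cases ha : a = 0
  · simp [ha]
  · have ha' := (ratVal.ne_zero_iff).2 ha
    rw [← WithZero.exp_log ha', ← WithZero.exp_add, Ne, WithZero.exp_inj]
    omega

instance (lam : ℂ) : Fact (∀ r : RatFunc ℂ, r ^ 2 ≠ cubicRat lam + 0 * r) where
  out r h := ratVal_sq_ne lam (a := r) one_ne_zero (congrArg ratVal (by linear_combination h))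

theorem ratVal_norm (lam : ℂ) (z : FunField lam) :
    ratVal z.norm = max (ratVal z.re ^ 2) (WithZero.exp 3 * ratVal z.im ^ 2) := by
  rw [QuadraticAlgebra.norm_def, zero_mul, zero_mul, add_zero]
  by_cases hb : z.im = 0
  · simp [hb, sq]
  · rw [sub_eq_add_neg, Valuation.map_add_of_distinct_val _ (by
      rw [Valuation.map_neg]; exact ratVal_sq_ne lam hb), Valuation.map_neg]
    simp only [map_mul, ratVal_cubicRat, sq, mul_assoc]

/-- The valuation of the function field of the Legendre curve at the point at infinity. -/
def infVal (lam : ℂ) : Valuation (FunField lam) (WithZero (Multiplicative ℤ)) where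
  toFun z := ratVal z.norm
  map_zero' := by simp
  map_one' := by simp
  map_mul' a b := by simp
  map_add_le_max' a b := by
    simp only [ratVal_norm]
    have key (s t : RatFunc ℂ) : ratVal (s + t) ^ 2 ≤ max (ratVal s ^ 2) (ratVal t ^ 2) := by
      rcases le_total (ratVal s) (ratVal t) with h | h
      · exact le_max_of_le_right
          (pow_le_pow_left' ((ratVal.map_add s t).trans (max_le h le_rfl)) 2)
      · exact le_max_of_le_left
          (pow_le_pow_left' ((ratVal.map_add s t).trans (max_le le_rfl h)) 2)
    refine max_le ((key _ _).trans ?_) ((mul_le_mul_right (key _ _) _).trans ?_)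
    · exact max_le_max (le_max_left _ _) (le_max_left _ _)
    · rw [mul_max]
      exact max_le_max (le_max_right _ _) (le_max_right _ _)

theorem infVal_apply (lam : ℂ) (z : FunField lam) : infVal lam z = ratVal z.norm := rfl

theorem infVal_star {lam : ℂ} (z : FunField lam) : infVal lam (star z) = infVal lam z := by
  rw [infVal_apply, infVal_apply, QuadraticAlgebra.norm_star]

theorem infVal_algebraMap {lam : ℂ} (h : RatFunc ℂ) :
    infVal lam (algebraMap _ _ h) = ratVal h ^ 2 := by
  rw [infVal_apply, QuadraticAlgebra.norm_algebraMap, map_pow]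

/-- The constants in the function field. -/
def const (lam : ℂ) : ℂ →+* FunField lam :=
  (algebraMap (RatFunc ℂ) (FunField lam)).comp RatFunc.C

theorem const_apply (lam k : ℂ) : const lam k = algebraMap _ _ (RatFunc.C k) := rfl

theorem star_algebraMap {lam : ℂ} (h : RatFunc ℂ) :
    star (algebraMap (RatFunc ℂ) (FunField lam) h) = algebraMap _ _ h := by
  ext <;> simp

theorem star_const {lam : ℂ} (k : ℂ) : star (const lam k) = const lam k :=
  star_algebraMap _

theorem infVal_const {lam k : ℂ} (hk : k ≠ 0) : infVal lam (const lam k) = 1 := by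
  rw [const_apply, infVal_algebraMap, ratVal_C hk, one_pow]

theorem infVal_const_le {lam : ℂ} (k : ℂ) : infVal lam (const lam k) ≤ 1 := by
  by_cases hk : k = 0
  · simp [hk]
  · rw [infVal_const hk]

theorem eq_algebraMap_of_star_eq {lam : ℂ} {z : FunField lam} (h : star z = z) :
    z = algebraMap _ _ z.re := by
  have h' := congrArg QuadraticAlgebra.im h
  simp only [QuadraticAlgebra.im_star] at h'
  ext
  · simp
  · have : z.im = 0 := by
      have h2 : (2 : RatFunc ℂ) * z.im = 0 := by linear_combination -h'
      exact (mul_eq_zero.1 h2).resolve_left two_ne_zero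
    simp [this]

theorem eq_mul_omega_of_star_eq_neg {lam : ℂ} {z : FunField lam} (h : star z = -z) :
    z = algebraMap _ _ z.im * QuadraticAlgebra.omega := by
  have h' := congrArg QuadraticAlgebra.re h
  simp only [QuadraticAlgebra.re_star, zero_mul, add_zero, QuadraticAlgebra.re_neg] at h'
  ext
  · have : z.re = 0 := by
      have h2 : (2 : RatFunc ℂ) * z.re = 0 := by linear_combination h'
      exact (mul_eq_zero.1 h2).resolve_left two_ne_zero
    simp [this]
  · simp

theorem eq_const_of_star_eq {lam : ℂ} (h0 : lam ≠ 0) (h1 : lam ≠ 1) {x y : FunField lam}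
    (hx : star x = x) (hy : star y = y)
    (hxy : y ^ 2 = x * (x - 1) * (x - const lam lam)) :
    ∃ a b : ℂ, x = const lam a ∧ y = const lam b := by
  rw [eq_algebraMap_of_star_eq hx, eq_algebraMap_of_star_eq hy] at hxy ⊢
  obtain ⟨a, b, ha, hb⟩ := eq_C_of_sq_eq h0 h1 (x := x.re) (y := y.re)
    (QuadraticAlgebra.algebraMap_injective (a := cubicRat lam) (b := 0) (by
      simpa only [const_apply, map_mul, map_sub, map_pow, map_one] using hxy))
  exact ⟨a, b, by rw [ha, const_apply], by rw [hb, const_apply]⟩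

theorem infVal_sub_const {lam : ℂ} {u : FunField lam} (hu : 1 < infVal lam u) (k : ℂ) :
    infVal lam (u - const lam k) = infVal lam u :=
  Valuation.map_sub_eq_of_lt_left _ ((infVal_const_le k).trans_lt hu)

theorem infVal_sq {lam : ℂ} {u v : FunField lam}
    (huv : v ^ 2 = u * (u - 1) * (u - const lam lam)) (hu : 1 < infVal lam u) :
    infVal lam v ^ 2 = infVal lam u ^ 3 := by
  rw [← map_pow, huv, map_mul, map_mul, infVal_sub_const hu, ← map_one (const lam),
    infVal_sub_const hu, pow_three']

/-- Translating a point tending to infinity by a constant affine point gives a bounded point. -/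
theorem infVal_le_one_of_chord {lam : ℂ} {u v s m : FunField lam} {a b : ℂ}
    (huv : v ^ 2 = u * (u - 1) * (u - const lam lam)) (hu : 1 < infVal lam u)
    (hm : v - const lam b = m * (u - const lam a))
    (hs : s = m ^ 2 + 1 + const lam lam - u - const lam a) : infVal lam s ≤ 1 := by
  set w := infVal lam with hw
  have hu0 : 0 < w u := zero_lt_one.trans hu
  have hv : w v ≤ w u ^ 2 := by
    refine le_of_lt (lt_of_pow_lt_pow_left₀ 2 zero_le ?_)
    rw [infVal_sq huv hu, ← pow_mul]
    exact pow_lt_pow_right₀ hu (by norm_num)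
  have hu2 : w u ≤ w u ^ 2 := by
    simpa using pow_le_pow_right₀ hu.le one_le_two
  have h12 : 1 ≤ w u ^ 2 := hu.le.trans hu2
  have e : s * (u - const lam a) ^ 2 = const lam a * u ^ 2 +
      const lam (lam - 2 * a * (1 + lam - a) - a ^ 2) * u +
      const lam (b ^ 2 + a ^ 2 * (1 + lam - a)) - const lam (2 * b) * v := by
    simp only [map_sub, map_add, map_mul, map_pow, map_one, map_ofNat]
    rw [hs]
    linear_combination huv - (v - const lam b + m * (u - const lam a)) * hm
  have hc (k : ℂ) {t : FunField lam} (ht : w t ≤ w u ^ 2) : w (const lam k * t) ≤ w u ^ 2 := by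
    rw [map_mul]
    exact mul_le_of_le_one_of_le (infVal_const_le k) ht
  have hR : w (s * (u - const lam a) ^ 2) ≤ w u ^ 2 := by
    rw [e]
    refine w.map_sub_le (w.map_add_le (w.map_add_le (hc _ (map_pow w u 2).le) (hc _ hu2))
      ((infVal_const_le _).trans h12)) (hc _ hv)
  rw [map_mul, map_pow, infVal_sub_const hu] at hR
  exact (mul_le_iff_le_one_left (pow_pos hu0 2)).1 hR

/-- A nonconstant point of the Legendre curve over its function field which is the origin at
infinity is odd. -/
theorem star_eq_of_one_lt_infVal {lam : ℂ} (h0 : lam ≠ 0) (h1 : lam ≠ 1) {u v : FunField lam}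
    (huv : v ^ 2 = u * (u - 1) * (u - const lam lam)) (hu : 1 < infVal lam u) :
    star u = u ∧ star v = -v := by
  have huv' : star v ^ 2 = star u * (star u - 1) * (star u - const lam lam) := by
    have := congrArg star huv
    simpa only [star_pow, star_mul', star_sub, star_one, star_const] using this
  by_cases h : star u = u
  · refine ⟨h, ?_⟩
    rw [h, ← huv] at huv'
    refine (sq_eq_sq_iff_eq_or_eq_neg.1 huv').resolve_left fun hv => ?_
    obtain ⟨a, -, ha, -⟩ := eq_const_of_star_eq h0 h1 h hv huv
    rw [ha] at hu
    exact absurd (infVal_const_le a) (not_le.2 hu)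
  · exfalso
    have hne : u - star u ≠ 0 := sub_ne_zero.2 (Ne.symm h)
    obtain ⟨m, hm⟩ : ∃ m, m * (u - star u) = v - star v := ⟨_, div_mul_cancel₀ _ hne⟩
    have hms : star m = m := by
      have := congrArg star hm
      simp only [star_mul', star_sub, star_star] at this
      exact mul_right_cancel₀ hne (by linear_combination -this - hm)
    obtain ⟨X, hX⟩ : ∃ X, X = m ^ 2 + 1 + const lam lam - u - star u := ⟨_, rfl⟩
    have hXs : star X = X := by
      rw [hX]
      simp only [star_add, star_sub, star_pow, star_one, star_const, star_star, hms]
      ring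
    obtain ⟨Y, hY⟩ : ∃ Y, Y = v + m * (X - u) := ⟨_, rfl⟩
    have hYs : star Y = Y := by
      rw [hY]
      simp only [star_add, star_sub, star_mul', hms, hXs]
      linear_combination hm
    have hXY : Y ^ 2 = X * (X - 1) * (X - const lam lam) := by
      refine mul_right_cancel₀ hne ?_
      have hv' : star v = v - m * (u - star u) := by linear_combination hm
      rw [hv'] at huv'
      rw [hY, hX]
      generalize star u = u' at *
      linear_combination (m ^ 2 + 1 + const lam lam - u - 2 * u') * huv -
        (m ^ 2 + 1 + const lam lam - 2 * u - u') * huv'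
    obtain ⟨a, b, ha, hb⟩ := eq_const_of_star_eq h0 h1 hXs hYs hXY
    have := infVal_le_one_of_chord (s := star u) (m := m) (a := a) (b := b) huv hu
      (by rw [← ha, ← hb, hY]; ring) (by rw [← ha, hX]; ring)
    rw [infVal_star] at this
    exact absurd this (not_le.2 hu)

/-- Restriction of polynomials in homogeneous coordinates to the affine curve, as functions in
the function field. -/
def toFun (lam : ℂ) : MvPolynomial (Fin 3) ℂ →+* FunField lam :=
  MvPolynomial.eval₂Hom (const lam)
    ![algebraMap (RatFunc ℂ) (FunField lam) RatFunc.X, QuadraticAlgebra.omega, 1]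

theorem infVal_X (lam : ℂ) :
    infVal lam (algebraMap (RatFunc ℂ) (FunField lam) RatFunc.X) = WithZero.exp 2 := by
  rw [infVal_algebraMap, ← RatFunc.algebraMap_X, ratVal_algebraMap X_ne_zero, natDegree_X,
    ← WithZero.exp_nsmul]
  rfl

theorem infVal_omega (lam : ℂ) :
    infVal lam (QuadraticAlgebra.omega : FunField lam) = WithZero.exp 3 := by
  rw [infVal_apply, ratVal_norm]
  simp

theorem infVal_toFun_lt {lam : ℂ} {n : ℕ} {F : MvPolynomial (Fin 3) ℂ} (hF : F.IsHomogeneous n)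
    (h : F.eval ![0, 1, 0] = 0) : infVal lam (toFun lam F) < WithZero.exp (3 * n : ℤ) := by
  have hdeg {d : Fin 3 →₀ ℕ} (hd : d ∈ F.support) : d 0 + d 1 + d 2 = n := by
    have := hF (MvPolynomial.mem_support_iff.1 hd)
    rw [Finsupp.weight_apply] at this
    simpa [Finsupp.sum_fintype, Fin.sum_univ_three] using this
  have hcoeff : F.coeff (Finsupp.single 1 n) = 0 := by
    rw [← h, MvPolynomial.eval_eq', Finset.sum_eq_single (Finsupp.single 1 n)]
    · simp [Fin.prod_univ_three]
    · intro d hd hne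
      by_cases h02 : d 0 = 0 ∧ d 2 = 0
      · refine absurd ?_ hne
        have := hdeg hd
        ext i
        fin_cases i <;> simp [h02.1, h02.2]
        omega
      · rw [not_and_or] at h02
        rcases h02 with h | h <;> simp [Fin.prod_univ_three, h]
    · intro hd
      simp [MvPolynomial.notMem_support_iff.1 hd]
  rw [toFun, MvPolynomial.coe_eval₂Hom, MvPolynomial.eval₂_eq']
  refine Valuation.map_sum_lt _ WithZero.exp_ne_zero fun d hd => ?_
  have hlt : 2 * d 0 + 3 * d 1 < 3 * n := by
    have := hdeg hd
    by_contra hlt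
    refine MvPolynomial.mem_support_iff.1 hd ?_
    convert hcoeff
    ext i
    fin_cases i <;> simp <;> omega
  rw [map_mul, infVal_const (MvPolynomial.mem_support_iff.1 hd), one_mul]
  simp only [Fin.prod_univ_three, Matrix.cons_val_zero, Matrix.cons_val_one, Matrix.cons_val,
    one_pow, mul_one, map_mul, map_pow, infVal_X, infVal_omega]
  rw [← WithZero.exp_nsmul, ← WithZero.exp_nsmul, ← WithZero.exp_add, WithZero.exp_lt_exp]
  simp only [nsmul_eq_mul]
  omega

theorem infVal_toFun_eq {lam : ℂ} {n : ℕ} {F : MvPolynomial (Fin 3) ℂ} (hF : F.IsHomogeneous n)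
    (h : F.eval ![0, 1, 0] ≠ 0) : infVal lam (toFun lam F) = WithZero.exp (3 * n : ℤ) := by
  set k := F.eval ![0, 1, 0] with hk
  have hG := infVal_toFun_lt (lam := lam) (n := n)
    (hF.sub ((MvPolynomial.isHomogeneous_X_pow (R := ℂ) (1 : Fin 3) n).C_mul k)) (by simp [← hk])
  have hM : infVal lam (toFun lam (MvPolynomial.C k * MvPolynomial.X 1 ^ n)) =
      WithZero.exp (3 * n : ℤ) := by
    simp only [toFun, map_mul, map_pow, MvPolynomial.coe_eval₂Hom, MvPolynomial.eval₂_C,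
      MvPolynomial.eval₂_X]
    simp [infVal_const h, infVal_omega, ← WithZero.exp_nsmul, mul_comm]
  rw [← hM] at hG
  rw [← hM, ← Valuation.map_add_eq_of_lt_left _ hG, ← map_add]
  congr 2
  ring

theorem nonsingular_iff {lam : ℂ} (h0 : lam ≠ 0) (h1 : lam ≠ 1) {x y : ℂ} :
    (curve lam).Nonsingular x y ↔ y ^ 2 = (cubic lam).eval x := by
  rw [WeierstrassCurve.Affine.nonsingular_iff, WeierstrassCurve.Affine.equation_iff, eval_cubic]
  simp only [curve]
  constructor
  · rintro ⟨h, -⟩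
    linear_combination h
  · intro h
    refine ⟨by linear_combination h, ?_⟩
    by_contra hc
    simp only [not_or, not_not] at hc
    obtain ⟨hx, hy⟩ := hc
    have hy0 : y = 0 := by
      have : (2 : ℂ) * y = 0 := by linear_combination hy
      exact (mul_eq_zero.1 this).resolve_left two_ne_zero
    subst hy0
    have hxx : x * (x - 1) * (x - lam) = 0 := by linear_combination -h
    rcases mul_eq_zero.1 hxx with hxx | hxx
    · rcases mul_eq_zero.1 hxx with hxx | hxx
      · subst hxx
        exact h0 (by linear_combination -hx)
      · obtain rfl : x = 1 := sub_eq_zero.1 hxx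
        exact h1 (by linear_combination hx)
    · obtain rfl : x = lam := sub_eq_zero.1 hxx
      have : x * (x - 1) = 0 := by linear_combination -hx
      rcases mul_eq_zero.1 this with h | h
      exacts [h0 h, h1 (sub_eq_zero.1 h)]

theorem exists_xMap_eq {lam : ℂ} (h0 : lam ≠ 0) (h1 : lam ≠ 1) (x : ℂ) :
    ∃ P : Curve lam, xMap P = (x : OnePoint ℂ) := by
  obtain ⟨y, hy⟩ := IsAlgClosed.exists_pow_nat_eq ((cubic lam).eval x) two_pos
  exact ⟨.some x y ((nonsingular_iff h0 h1).2 hy), rfl⟩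

theorem infinite_curve {lam : ℂ} (h0 : lam ≠ 0) (h1 : lam ≠ 1) : Infinite (Curve lam) := by
  choose s hs using exists_xMap_eq h0 h1
  refine Infinite.of_injective s fun a b hab => ?_
  have := congrArg xMap hab
  rwa [hs, hs, OnePoint.coe_eq_coe] at this

/-- The fibre of the two-fold cover over a finite point. -/
theorem xMap_eq_coe_iff {lam : ℂ} (h0 : lam ≠ 0) (h1 : lam ≠ 1) {x y : ℂ}
    (h : y ^ 2 = (cubic lam).eval x) (P : Curve lam) :
    xMap P = (x : OnePoint ℂ) ↔ P = .some x y ((nonsingular_iff h0 h1).2 h) ∨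
      P = .some x (-y) ((nonsingular_iff h0 h1).2 ((neg_sq y).trans h)) := by
  constructor
  · intro hP
    rcases P with _ | ⟨x', y', h'⟩
    · exact absurd hP (OnePoint.infty_ne_coe x)
    · obtain rfl : x' = x := OnePoint.coe_injective hP
      have h'' := (nonsingular_iff h0 h1).1 h'
      rcases sq_eq_sq_iff_eq_or_eq_neg.1 (h''.trans h.symm) with rfl | rfl
      · exact Or.inl rfl
      · exact Or.inr rfl
  · rintro (rfl | rfl) <;> rfl

theorem finite_xMap_preimage {lam : ℂ} (h0 : lam ≠ 0) (h1 : lam ≠ 1) {s : Set (OnePoint ℂ)}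
    (hs : s.Finite) : (xMap ⁻¹' s : Set (Curve lam)).Finite := by
  refine hs.preimage' fun w _ => ?_
  induction w using OnePoint.rec with
  | infty =>
    refine (Set.finite_singleton (0 : Curve lam)).subset fun P hP => ?_
    rcases P with _ | ⟨x, y, h⟩
    · rfl
    · exact absurd hP (OnePoint.coe_ne_infty x)
  | coe x =>
    obtain ⟨y, hy⟩ := IsAlgClosed.exists_pow_nat_eq ((cubic lam).eval x) two_pos
    refine (Set.toFinite {_, _}).subset fun P hP => (xMap_eq_coe_iff h0 h1 hy P).1 hP

theorem exists_toFun_eq (lam : ℂ) (G : MvPolynomial (Fin 3) ℂ) :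
    ∃ a b : ℂ[X], toFun lam G = ⟨algebraMap _ _ a, algebraMap _ _ b⟩ ∧
      ∀ x y, y ^ 2 = (cubic lam).eval x → G.eval ![x, y, 1] = a.eval x + b.eval x * y := by
  induction G using MvPolynomial.induction_on with
  | C k =>
    refine ⟨C k, 0, ?_, by simp⟩
    rw [toFun, MvPolynomial.coe_eval₂Hom, MvPolynomial.eval₂_C, const_apply]
    ext <;> simp
  | add p q hp hq =>
    obtain ⟨a, b, h, h'⟩ := hp
    obtain ⟨c, d, k, k'⟩ := hq
    refine ⟨a + c, b + d, ?_, fun x y hxy => ?_⟩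
    · rw [map_add, h, k]
      ext <;> simp
    · rw [map_add, h' x y hxy, k' x y hxy, eval_add, eval_add]
      ring
  | mul_X p i hp =>
    obtain ⟨a, b, h, h'⟩ := hp
    fin_cases i
    · refine ⟨a * X, b * X, ?_, fun x y hxy => ?_⟩
      · rw [map_mul, h, toFun, MvPolynomial.coe_eval₂Hom, MvPolynomial.eval₂_X]
        ext <;> simp
      · rw [map_mul, h' x y hxy]
        simp
        ring
    · refine ⟨b * cubic lam, a, ?_, fun x y hxy => ?_⟩
      · rw [map_mul, h, toFun, MvPolynomial.coe_eval₂Hom, MvPolynomial.eval₂_X]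
        ext <;> simp [mul_comm]
      · rw [map_mul, h' x y hxy, eval_mul, ← hxy]
        simp
        ring
    · refine ⟨a, b, ?_, fun x y hxy => ?_⟩
      · rw [map_mul, h, toFun, MvPolynomial.coe_eval₂Hom, MvPolynomial.eval₂_X]
        ext <;> simp
      · rw [map_mul, h' x y hxy]
        simp

theorem eval_coords_eq_zero {lam : ℂ} (h0 : lam ≠ 0) (h1 : lam ≠ 1) {G : MvPolynomial (Fin 3) ℂ}
    (hG : toFun lam G = 0) {P : Curve lam} (hP : P ≠ 0) : G.eval (coords P) = 0 := by
  rcases P with _ | ⟨x, y, h⟩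
  · exact absurd rfl hP
  · obtain ⟨a, b, e, e'⟩ := exists_toFun_eq lam G
    rw [hG, QuadraticAlgebra.ext_iff] at e
    obtain ⟨ha, hb⟩ := e
    have ha' : a = 0 := RatFunc.algebraMap_injective ℂ (by simpa using ha.symm)
    have hb' : b = 0 := RatFunc.algebraMap_injective ℂ (by simpa using hb.symm)
    exact (e' x y ((nonsingular_iff h0 h1).1 h)).trans (by simp [ha', hb'])

theorem eventually_eval_coords_ne_zero {lam : ℂ} (h0 : lam ≠ 0) (h1 : lam ≠ 1)
    {G : MvPolynomial (Fin 3) ℂ} (hG : toFun lam G ≠ 0) :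
    ∀ᶠ P : Curve lam in cofinite, G.eval (coords P) ≠ 0 := by
  obtain ⟨a, b, e, e'⟩ := exists_toFun_eq lam G
  set N : ℂ[X] := a * a - cubic lam * b * b with hN
  have hN0 : N ≠ 0 := by
    rintro hN0
    refine hG (QuadraticAlgebra.norm_eq_zero_iff_eq_zero.1 ?_)
    rw [e, QuadraticAlgebra.norm_def]
    simpa [hN] using congrArg (algebraMap ℂ[X] (RatFunc ℂ)) hN0
  have hfin : (insert OnePoint.infty ((fun z : ℂ => (z : OnePoint ℂ)) '' {z | N.IsRoot z})).Finite :=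
    ((finite_setOfPred_isRoot hN0).image _).insert _
  rw [eventually_cofinite]
  refine (finite_xMap_preimage h0 h1 hfin).subset fun P hP => ?_
  rcases P with _ | ⟨x, y, h⟩
  · exact Or.inl rfl
  · refine Or.inr ⟨x, ?_, rfl⟩
    have hxy := (nonsingular_iff h0 h1).1 h
    have hz : a.eval x + b.eval x * y = 0 := by
      rw [← e' x y hxy]
      simpa [coords] using hP
    simp only [hN, Set.mem_ofPred_eq, IsRoot.def, eval_sub, eval_mul]
    rw [← hxy]
    linear_combination (a.eval x - b.eval x * y) * hz

theorem toFun_eq_zero_of_eventually {lam : ℂ} (h0 : lam ≠ 0) (h1 : lam ≠ 1)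
    {G : MvPolynomial (Fin 3) ℂ} (hG : ∀ᶠ P : Curve lam in cofinite, G.eval (coords P) = 0) :
    toFun lam G = 0 := by
  have := infinite_curve h0 h1
  by_contra h
  obtain ⟨P, hP, hP'⟩ := (hG.and (eventually_eval_coords_ne_zero h0 h1 h)).exists
  exact hP' hP

theorem toFun_ne_zero {lam : ℂ} (h0 : lam ≠ 0) (h1 : lam ≠ 1) {G : MvPolynomial (Fin 3) ℂ} {n : ℕ}
    (hG : G.IsHomogeneous n) {P : Curve lam} (hP : G.eval (coords P) ≠ 0) : toFun lam G ≠ 0 := by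
  by_cases hP0 : P = 0
  · subst hP0
    rw [← (infVal lam).ne_zero_iff, infVal_toFun_eq hG hP]
    exact WithZero.exp_ne_zero
  · exact fun h => hP (eval_coords_eq_zero h0 h1 h hP0)

/-- The polynomials `F` are homogeneous coordinates of `f` at all but finitely many points. -/
def IsFormula {lam : ℂ} (f : Curve lam → Curve lam) (F : Fin 3 → MvPolynomial (Fin 3) ℂ) : Prop :=
  ∀ᶠ Q : Curve lam in cofinite, ∃ c : ℂ, c ≠ 0 ∧ ∀ i, (F i).eval (coords Q) = c * coords (f Q) i

theorem isFormula_of_eval_ne_zero {lam : ℂ} (h0 : lam ≠ 0) (h1 : lam ≠ 1)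
    {f : Curve lam → Curve lam} {n : ℕ} {F : Fin 3 → MvPolynomial (Fin 3) ℂ}
    (hn : ∀ i, (F i).IsHomogeneous n) {P : Curve lam} (hP : ∃ i, (F i).eval (coords P) ≠ 0)
    (hF : ∀ Q : Curve lam, (∃ i, (F i).eval (coords Q) ≠ 0) →
      ∃ c : ℂ, c ≠ 0 ∧ ∀ i, (F i).eval (coords Q) = c * coords (f Q) i) : IsFormula f F := by
  obtain ⟨i, hi⟩ := hP
  filter_upwards [eventually_eval_coords_ne_zero h0 h1 (toFun_ne_zero h0 h1 (hn i) hi)] with Q hQ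
  exact hF Q ⟨i, hQ⟩

theorem not_eventually_eq_zero {lam : ℂ} (h0 : lam ≠ 0) (h1 : lam ≠ 1)
    {f : Curve lam → Curve lam} {D : ℕ} (hD : 0 < D) (hf : HasDegree f D) :
    ¬ ∀ᶠ Q in cofinite, f Q = 0 := by
  intro h
  have := infinite_curve h0 h1
  rw [eventually_cofinite] at h
  have hsub : (Set.univ : Set (Curve lam)) ⊆
      (insert 0 (f '' {Q | ¬ f Q = 0})) ∪ {Q | (f ⁻¹' {Q}).encard ≠ (D : ℕ∞)} := by
    intro R _
    by_cases hR : (f ⁻¹' {R}).encard = (D : ℕ∞)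
    · left
      have hne : (f ⁻¹' {R}).Nonempty := by
        rw [← Set.encard_ne_zero, hR]
        exact_mod_cast hD.ne'
      obtain ⟨Q, rfl⟩ := hne
      by_cases hQ : f Q = 0
      · exact Or.inl hQ
      · exact Or.inr ⟨Q, hQ, rfl⟩
    · exact Or.inr hR
  exact Set.infinite_univ ((((h.image f).insert 0).union hf).subset hsub)

theorem coords_curve {lam : ℂ} (h0 : lam ≠ 0) (h1 : lam ≠ 1) (P : Curve lam) :
    coords P 1 ^ 2 * coords P 2 =
      coords P 0 * (coords P 0 - coords P 2) * (coords P 0 - lam * coords P 2) := by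
  rcases P with _ | ⟨x, y, h⟩
  · simp [coords]
  · have := (nonsingular_iff h0 h1).1 h
    rw [eval_cubic] at this
    simpa [coords] using this

theorem coords_two_eq_zero {lam : ℂ} {P : Curve lam} (h : coords P 2 = 0) : P = 0 := by
  rcases P with _ | ⟨x, y, h'⟩
  · rfl
  · simp [coords] at h

theorem xMap_eq_coe {lam : ℂ} {P : Curve lam} (h : coords P 2 ≠ 0) :
    xMap P = ((coords P 0 / coords P 2 : ℂ) : OnePoint ℂ) := by
  rcases P with _ | ⟨x, y, h'⟩
  · simp [coords] at h
  · simp [coords, xMap]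

section Formula

variable {lam : ℂ} {f : Curve lam → Curve lam} {F G : Fin 3 → MvPolynomial (Fin 3) ℂ}

theorem IsFormula.toFun_two_ne_zero (h0 : lam ≠ 0) (h1 : lam ≠ 1) {D : ℕ} (hD : 0 < D)
    (hf : HasDegree f D) (hF : IsFormula f F) : toFun lam (F 2) ≠ 0 := by
  intro h
  refine not_eventually_eq_zero h0 h1 hD hf ?_
  filter_upwards [hF, (Set.finite_singleton (0 : Curve lam)).eventually_cofinite_notMem]
    with Q ⟨c, hc, hQ⟩ hQ0
  refine coords_two_eq_zero ((mul_eq_zero.1 ?_).resolve_left hc)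
  rw [← hQ, eval_coords_eq_zero h0 h1 h hQ0]

theorem IsFormula.toFun_curve (h0 : lam ≠ 0) (h1 : lam ≠ 1) (hF : IsFormula f F) :
    toFun lam (F 1) ^ 2 * toFun lam (F 2) = toFun lam (F 0) * (toFun lam (F 0) - toFun lam (F 2)) *
      (toFun lam (F 0) - const lam lam * toFun lam (F 2)) := by
  have hC : toFun lam (MvPolynomial.C lam) = const lam lam := by simp [toFun]
  rw [← sub_eq_zero, ← hC]
  simp only [← map_mul, ← map_sub, ← map_pow]
  refine toFun_eq_zero_of_eventually h0 h1 ?_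
  filter_upwards [hF] with Q ⟨c, hc, hQ⟩
  simp only [map_sub, map_mul, map_pow, MvPolynomial.eval_C, hQ]
  linear_combination c ^ 3 * coords_curve h0 h1 (f Q)

theorem IsFormula.toFun_mul_comm (h0 : lam ≠ 0) (h1 : lam ≠ 1) (hF : IsFormula f F)
    (hG : IsFormula f G) (i j : Fin 3) :
    toFun lam (F i) * toFun lam (G j) = toFun lam (F j) * toFun lam (G i) := by
  rw [← sub_eq_zero]
  simp only [← map_mul, ← map_sub]
  refine toFun_eq_zero_of_eventually h0 h1 ?_
  filter_upwards [hF, hG] with Q ⟨c, hc, hQ⟩ ⟨d, hd, hQ'⟩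
  simp only [map_sub, map_mul, hQ, hQ']
  ring

end Formula

/-- A polynomial in one variable as a polynomial in the first homogeneous coordinate. -/
def inX (p : ℂ[X]) : MvPolynomial (Fin 3) ℂ := p.eval₂ MvPolynomial.C (MvPolynomial.X 0)

theorem toFun_inX (lam : ℂ) (p : ℂ[X]) :
    toFun lam (inX p) = algebraMap _ _ (algebraMap ℂ[X] (RatFunc ℂ) p) := by
  have : (toFun lam).comp (eval₂RingHom MvPolynomial.C (MvPolynomial.X 0)) =
      (algebraMap (RatFunc ℂ) (FunField lam)).comp (algebraMap ℂ[X] (RatFunc ℂ)) := by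
    refine Polynomial.ringHom_ext (fun k => ?_) ?_
    · simp [toFun, const_apply]
    · simp [toFun]
  exact congrArg (fun φ => φ p) this

theorem eval_inX (p : ℂ[X]) (c : Fin 3 → ℂ) : (inX p).eval c = p.eval (c 0) := by
  rw [inX, Polynomial.hom_eval₂, MvPolynomial.eval_X]
  have : (MvPolynomial.eval c).comp MvPolynomial.C = RingHom.id ℂ := by
    ext k
    simp
  rw [this, eval₂_id]

theorem value_infty {h : RatFunc ℂ} (hdeg : h.denom.natDegree < h.num.natDegree) :
    value h OnePoint.infty = OnePoint.infty := by
  have : h.denom.coeff (degree h) = 0 :=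
    coeff_eq_zero_of_natDegree_lt (hdeg.trans_le (le_max_left _ _))
  exact if_pos this

theorem value_coe_of_eq_zero {h : RatFunc ℂ} {z : ℂ} (hz : h.denom.eval z = 0) :
    value h (z : OnePoint ℂ) = OnePoint.infty :=
  if_pos hz

theorem value_coe_of_ne_zero {h : RatFunc ℂ} {z : ℂ} (hz : h.denom.eval z ≠ 0) :
    value h (z : OnePoint ℂ) = ((h.num.eval z / h.denom.eval z : ℂ) : OnePoint ℂ) :=
  if_neg hz

/-- The values of `f` at all points are determined by a rational function on the function
field. -/
theorem induces_of_toFun {lam : ℂ} (h0 : lam ≠ 0) (h1 : lam ≠ 1) {D : ℕ} (hD : 0 < D)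
    {f : Curve lam → Curve lam} (hfD : HasDegree f D) (hf : IsMorphism f) (hf0 : f 0 = 0)
    {F : Fin 3 → MvPolynomial (Fin 3) ℂ} (hF : IsFormula f F) {h : RatFunc ℂ}
    (hdeg : h.denom.natDegree < h.num.natDegree)
    (hh : toFun lam (F 0) = algebraMap _ _ h * toFun lam (F 2)) : Induces f h := by
  intro P
  obtain ⟨n, G, hn, hP, hG⟩ := hf P
  have hG' := isFormula_of_eval_ne_zero h0 h1 hn hP hG
  have hF2 := hF.toFun_two_ne_zero h0 h1 hD hfD
  have hG2 := hG'.toFun_two_ne_zero h0 h1 hD hfD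
  by_cases hP0 : P = 0
  · rw [hP0, hf0]
    exact (value_infty hdeg).symm
  have hden : algebraMap (RatFunc ℂ) (FunField lam) h * toFun lam (inX h.denom) =
      toFun lam (inX h.num) := by
    rw [toFun_inX, toFun_inX, ← map_mul, mul_algebraMap_denom]
  have e1 : toFun lam (G 0) * toFun lam (inX h.denom) =
      toFun lam (G 2) * toFun lam (inX h.num) := by
    refine mul_right_cancel₀ hF2 ?_
    rw [← hden]
    have := hG'.toFun_mul_comm h0 h1 hF 0 2
    rw [hh] at this
    linear_combination toFun lam (inX h.denom) * this
  have e2 : (toFun lam (G 1) ^ 2 + const lam (1 + lam) * toFun lam (G 0) ^ 2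
      - const lam lam * toFun lam (G 0) * toFun lam (G 2)) * toFun lam (inX h.denom) =
      toFun lam (G 0) ^ 2 * toFun lam (inX h.num) := by
    refine mul_right_cancel₀ hG2 ?_
    rw [map_add, map_one]
    linear_combination toFun lam (inX h.denom) * hG'.toFun_curve h0 h1 +
      toFun lam (G 0) ^ 2 * e1
  have hC (k : ℂ) : const lam k = toFun lam (MvPolynomial.C k) := by simp [toFun]
  rw [← sub_eq_zero] at e1 e2
  simp only [hC, ← map_mul, ← map_sub, ← map_pow, ← map_add] at e1 e2
  replace e1 := eval_coords_eq_zero h0 h1 e1 hP0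
  replace e2 := eval_coords_eq_zero h0 h1 e2 hP0
  obtain ⟨c, hc, hcP⟩ := hG P hP
  simp only [map_sub, map_mul, map_add, map_pow, map_one, MvPolynomial.eval_C, eval_inX, hcP]
    at e1 e2
  rcases P with _ | ⟨x, y, hxy⟩
  · exact absurd rfl hP0
  change xMap _ = value h (x : OnePoint ℂ)
  change _ * h.denom.eval x - _ * h.num.eval x = 0 at e1
  change _ * h.denom.eval x - _ * h.num.eval x = 0 at e2
  by_cases hQ : f (.some x y hxy) = 0
  · rw [hQ] at e2 ⊢
    have hx : h.denom.eval x = 0 := by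
      change (_ + _ * (_ * (0 : ℂ)) ^ 2 - _ * (_ * (0 : ℂ)) * (_ * (0 : ℂ))) * _ -
        (_ * (0 : ℂ)) ^ 2 * _ = 0 at e2
      change ((c * (1 : ℂ)) ^ 2 + _ * (_ * (0 : ℂ)) ^ 2 - _ * (_ * (0 : ℂ)) * (_ * (0 : ℂ))) * _ -
        (_ * (0 : ℂ)) ^ 2 * _ = 0 at e2
      simpa [hc] using e2
    rw [value_coe_of_eq_zero hx]
    rfl
  · have hZ : coords (f (.some x y hxy)) 2 ≠ 0 := fun h => hQ (coords_two_eq_zero h)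
    have e3 : coords (f (.some x y hxy)) 0 * h.denom.eval x =
        coords (f (.some x y hxy)) 2 * h.num.eval x :=
      mul_left_cancel₀ hc (by linear_combination e1)
    have hx : h.denom.eval x ≠ 0 := by
      intro hx
      rw [hx, mul_zero, eq_comm, mul_eq_zero, or_iff_right hZ] at e3
      exact eval_ne_zero_of_isCoprime h.isCoprime_num_denom hx e3
    rw [value_coe_of_ne_zero hx, xMap_eq_coe hZ, OnePoint.coe_eq_coe, div_eq_div_iff hZ hx, e3,
      mul_comm]

theorem natDegree_lt_of_one_lt_ratVal {h : RatFunc ℂ} (hh : 1 < ratVal h) :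
    h.denom.natDegree < h.num.natDegree := by
  have hn : h.num ≠ 0 := by
    intro h0
    rw [RatFunc.num_eq_zero_iff.1 h0, map_zero] at hh
    exact absurd hh (by simp)
  have := congrArg ratVal (mul_algebraMap_denom h)
  rw [map_mul, ratVal_algebraMap hn, ratVal_algebraMap h.denom_ne_zero] at this
  have hlt := mul_lt_mul_of_pos_right hh (WithZero.exp_pos (a := (h.denom.natDegree : ℤ)))
  rw [this, one_mul, WithZero.exp_lt_exp] at hlt
  exact_mod_cast hlt

theorem exists_induces {lam : ℂ} (h0 : lam ≠ 0) (h1 : lam ≠ 1) {D : ℕ} (hD : 0 < D)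
    {f : Curve lam → Curve lam} (hfD : HasDegree f D) (hf : IsMorphism f) (hf0 : f 0 = 0) :
    ∃ h g : RatFunc ℂ, g ^ 2 * cubicRat lam = h * (h - 1) * (h - RatFunc.C lam) ∧
      h.denom.natDegree < h.num.natDegree ∧ Induces f h := by
  obtain ⟨n, F, hn, hP, hF⟩ := hf 0
  have hF' := isFormula_of_eval_ne_zero h0 h1 hn hP hF
  have hF2 := hF'.toFun_two_ne_zero h0 h1 hD hfD
  obtain ⟨c, hc, hc0⟩ := hF 0 hP
  rw [hf0] at hc0
  have hv1 : infVal lam (toFun lam (F 1)) = WithZero.exp (3 * n : ℤ) :=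
    infVal_toFun_eq (hn 1) (by
      have : (F 1).eval ![0, 1, 0] = c * 1 := hc0 1
      rwa [this, mul_one])
  have hv2 : infVal lam (toFun lam (F 2)) < WithZero.exp (3 * n : ℤ) :=
    infVal_toFun_lt (hn 2) (by
      have : (F 2).eval ![0, 1, 0] = c * 0 := hc0 2
      rw [this, mul_zero])
  obtain ⟨u, hu⟩ : ∃ u, toFun lam (F 0) = u * toFun lam (F 2) :=
    ⟨_, (div_mul_cancel₀ _ hF2).symm⟩
  obtain ⟨v, hv⟩ : ∃ v, toFun lam (F 1) = v * toFun lam (F 2) :=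
    ⟨_, (div_mul_cancel₀ _ hF2).symm⟩
  have huv : v ^ 2 = u * (u - 1) * (u - const lam lam) := by
    have := hF'.toFun_curve h0 h1
    rw [hu, hv] at this
    exact mul_right_cancel₀ (pow_ne_zero 3 hF2) (by linear_combination this)
  have hv_gt : 1 < infVal lam v := by
    rw [← hv1, hv, map_mul] at hv2
    by_contra hle
    exact absurd (mul_le_of_le_one_left zero_le (not_lt.1 hle)) (not_le.2 hv2)
  have hu_gt : 1 < infVal lam u := by
    by_contra hle
    have hle := not_lt.1 hle
    have hk (k : ℂ) : infVal lam (u - const lam k) ≤ 1 :=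
      (infVal lam).map_sub_le hle (infVal_const_le k)
    have h2 : infVal lam (v ^ 2) ≤ 1 := by
      rw [huv, map_mul, map_mul, ← map_one (const lam)]
      exact mul_le_one' (mul_le_one' hle (hk 1)) (hk lam)
    rw [map_pow] at h2
    exact absurd h2 (not_le.2 (one_lt_pow₀ hv_gt two_ne_zero))
  obtain ⟨hus, hvs⟩ := star_eq_of_one_lt_infVal h0 h1 huv hu_gt
  have hu' := eq_algebraMap_of_star_eq hus
  have hv' := eq_mul_omega_of_star_eq_neg hvs
  have hdeg : u.re.denom.natDegree < u.re.num.natDegree := by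
    refine natDegree_lt_of_one_lt_ratVal ?_
    rw [hu', infVal_algebraMap] at hu_gt
    by_contra hle
    exact absurd (pow_le_one' (not_lt.1 hle) 2) (not_le.2 hu_gt)
  refine ⟨u.re, v.im, ?_, hdeg, ?_⟩
  · rw [hu', hv'] at huv
    have hω : (QuadraticAlgebra.omega : FunField lam) * QuadraticAlgebra.omega =
        algebraMap _ _ (cubicRat lam) := by
      ext <;> simp
    refine QuadraticAlgebra.algebraMap_injective (a := cubicRat lam) (b := 0) ?_
    simp only [map_mul, map_sub, map_pow, map_one]
    rw [const_apply] at huv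
    rw [← huv, ← hω]
    ring
  · exact induces_of_toFun h0 h1 hD hfD hf hf0 hF' hdeg (by rw [← hu', hu])

theorem eq_of_induces {lam : ℂ} (h0 : lam ≠ 0) (h1 : lam ≠ 1) {f : Curve lam → Curve lam}
    {h k : RatFunc ℂ} (hh : Induces f h) (hk : Induces f k) : h = k := by
  have hval (z : ℂ) : value h (z : OnePoint ℂ) = value k (z : OnePoint ℂ) := by
    obtain ⟨P, hP⟩ := exists_xMap_eq h0 h1 z
    rw [← hP, ← hh, ← hk]
  have e : h.num * k.denom = k.num * h.denom := by
    refine mul_right_cancel₀ (mul_ne_zero h.denom_ne_zero k.denom_ne_zero) (funext fun z => ?_)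
    simp only [eval_mul]
    by_cases hz : h.denom.eval z = 0
    · simp [hz]
    by_cases hz' : k.denom.eval z = 0
    · simp [hz']
    have := hval z
    rw [value_coe_of_ne_zero hz, value_coe_of_ne_zero hz', OnePoint.coe_eq_coe,
      div_eq_div_iff hz hz'] at this
    rw [this]
  rw [← RatFunc.num_div_denom h, ← RatFunc.num_div_denom k,
    div_eq_div_iff (algebraMap_denom_ne_zero h) (algebraMap_denom_ne_zero k), ← map_mul, e, map_mul]

theorem multiplicity_coe {h : RatFunc ℂ} (hW : wronskian h.num h.denom ≠ 0) (z : ℂ) :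
    multiplicity h (z : OnePoint ℂ) = (wronskian h.num h.denom).rootMultiplicity z + 1 := by
  change (fibrePoly h (value h (z : OnePoint ℂ))).rootMultiplicity z = _
  by_cases hz : h.denom.eval z = 0
  · rw [value_coe_of_eq_zero hz]
    exact rootMultiplicity_denom hW h.isCoprime_num_denom hz
  · rw [value_coe_of_ne_zero hz]
    refine rootMultiplicity_sub_C_mul hW hz ?_
    rw [eval_sub, eval_mul, eval_C, div_mul_cancel₀ _ hz, sub_self]

theorem degree_eq {h : RatFunc ℂ} (hdeg : h.denom.natDegree < h.num.natDegree) :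
    degree h = h.num.natDegree :=
  max_eq_left hdeg.le

theorem multiplicity_infty {h : RatFunc ℂ} (hdeg : h.denom.natDegree < h.num.natDegree) :
    multiplicity h OnePoint.infty = h.num.natDegree - h.denom.natDegree := by
  change degree h - (fibrePoly h (value h OnePoint.infty)).natDegree = _
  rw [value_infty hdeg, degree_eq hdeg]
  rfl

theorem value_coe_eq_coe_iff {h : RatFunc ℂ} {z w : ℂ} :
    value h (z : OnePoint ℂ) = (w : OnePoint ℂ) ↔ (h.num - C w * h.denom).eval z = 0 := by
  rw [eval_sub, eval_mul, eval_C, sub_eq_zero]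
  by_cases hz : h.denom.eval z = 0
  · rw [value_coe_of_eq_zero hz, hz, mul_zero]
    exact iff_of_false (OnePoint.infty_ne_coe w)
      (eval_ne_zero_of_isCoprime h.isCoprime_num_denom hz)
  · rw [value_coe_of_ne_zero hz, OnePoint.coe_eq_coe, div_eq_iff hz]

theorem value_coe_mem_fourPoints {lam : ℂ} {h : RatFunc ℂ} {z : ℂ}
    (hz : (branchForm lam h.num h.denom).eval z = 0) :
    value h (z : OnePoint ℂ) ∈ fourPoints lam := by
  simp only [fourPoints, Set.mem_insert_iff, Set.mem_singleton_iff, value_coe_eq_coe_iff]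
  rw [branchForm_eq, eval_mul, mul_eq_zero, eval_mul, mul_eq_zero, eval_mul, mul_eq_zero] at hz
  rcases hz with ((hz | hz) | hz) | hz
  · exact Or.inl hz
  · exact Or.inr (Or.inl hz)
  · exact Or.inr (Or.inr (Or.inl hz))
  · exact Or.inr (Or.inr (Or.inr (value_coe_of_eq_zero hz)))

theorem encard_setOf_isRoot {p : ℂ[X]} (hp : p ≠ 0)
    (hsimple : ∀ z, p.eval z = 0 → p.rootMultiplicity z = 1) :
    {z | p.eval z = 0}.encard = (p.natDegree : ℕ∞) := by
  classical
  have hnodup : p.roots.Nodup := by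
    refine Multiset.nodup_iff_count_le_one.2 fun z => ?_
    rw [count_roots]
    by_cases hz : p.eval z = 0
    · exact (hsimple z hz).le
    · rw [rootMultiplicity_eq_zero hz]
      exact zero_le_one
  have hset : {z | p.eval z = 0} = (p.roots.toFinset : Set ℂ) := by
    ext z
    simp [hp]
  rw [hset, Set.encard_coe_eq_coe_finsetCard, Multiset.toFinset_card_of_nodup hnodup,
    ← (IsAlgClosed.splits p).natDegree_eq_card_roots]

/-- A set of finite points avoiding the branch points has twice as many points above it. -/
theorem encard_xMap_preimage {lam : ℂ} (h0 : lam ≠ 0) (h1 : lam ≠ 1) {S : Set ℂ}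
    (hS : ∀ z ∈ S, (cubic lam).eval z ≠ 0) :
    {P : Curve lam | ∃ z ∈ S, xMap P = (z : OnePoint ℂ)}.encard = S.encard + S.encard := by
  choose s hs using fun z => IsAlgClosed.exists_pow_nat_eq ((cubic lam).eval z) two_pos
  let p (z : ℂ) : Curve lam := .some z (s z) ((nonsingular_iff h0 h1).2 (hs z))
  let q (z : ℂ) : Curve lam :=
    .some z (-s z) ((nonsingular_iff h0 h1).2 ((neg_sq (s z)).trans (hs z)))
  have hp (z : ℂ) : xMap (p z) = (z : OnePoint ℂ) := rfl
  have hq (z : ℂ) : xMap (q z) = (z : OnePoint ℂ) := rfl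
  have hpi : Function.Injective p := fun a b hab => by
    simpa only [hp, OnePoint.coe_eq_coe] using congrArg xMap hab
  have hqi : Function.Injective q := fun a b hab => by
    simpa only [hq, OnePoint.coe_eq_coe] using congrArg xMap hab
  have hunion : {P : Curve lam | ∃ z ∈ S, xMap P = (z : OnePoint ℂ)} = p '' S ∪ q '' S := by
    ext P
    constructor
    · rintro ⟨z, hz, hP⟩
      rcases (xMap_eq_coe_iff h0 h1 (hs z) P).1 hP with rfl | rfl
      · exact Or.inl ⟨z, hz, rfl⟩
      · exact Or.inr ⟨z, hz, rfl⟩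
    · rintro (⟨z, hz, rfl⟩ | ⟨z, hz, rfl⟩)
      · exact ⟨z, hz, hp z⟩
      · exact ⟨z, hz, hq z⟩
  have hdisj : Disjoint (p '' S) (q '' S) := by
    rw [Set.disjoint_left]
    rintro _ ⟨a, ha, rfl⟩ ⟨b, -, hab⟩
    obtain rfl : b = a := by simpa only [hp, hq, OnePoint.coe_eq_coe] using congrArg xMap hab
    have hy : -s b = s b := by
      simp only [p, q, WeierstrassCurve.Affine.Point.some.injEq, true_and] at hab
      exact hab
    have hy0 : s b = 0 := by
      have : (2 : ℂ) * s b = 0 := by linear_combination -hy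
      exact (mul_eq_zero.1 this).resolve_left two_ne_zero
    refine hS b ha ?_
    rw [← hs, hy0]
    simp
  rw [hunion, Set.encard_union_eq hdisj, hpi.encard_image, hqi.encard_image]

/-- The degree of the induced rational function is the degree of the map of curves, computed by
counting the points above a general point of the sphere in two ways. -/
theorem natDegree_num_eq {lam : ℂ} (h0 : lam ≠ 0) (h1 : lam ≠ 1) {D : ℕ}
    {f : Curve lam → Curve lam} (hfD : HasDegree f D) {h : RatFunc ℂ} (hh : Induces f h)
    (hdeg : h.denom.natDegree < h.num.natDegree)
    (hc : ∀ z, (cubic lam).eval z = 0 → value h (z : OnePoint ℂ) ∈ fourPoints lam) :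
    h.num.natDegree = D := by
  have hW := wronskian_ne_zero_of_natDegree_lt h.isCoprime_num_denom hdeg
  have hbad : (xMap '' {Q : Curve lam | (f ⁻¹' {Q}).encard ≠ (D : ℕ∞)} ∪ fourPoints lam ∪
      (fun z : ℂ => value h (z : OnePoint ℂ)) '' {z | (wronskian h.num h.denom).IsRoot z}).Finite :=
    ((hfD.image _).union (by simp [fourPoints])).union ((finite_setOfPred_isRoot hW).image _)
  obtain ⟨_, ⟨w, rfl⟩, hw⟩ := ((Set.infinite_range_of_injective
    (OnePoint.coe_injective (X := ℂ))).sdiff hbad).nonempty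
  simp only [Set.mem_union, not_or] at hw
  obtain ⟨⟨hwE, hw4⟩, hwW⟩ := hw
  have hcard : {z | (h.num - C w * h.denom).eval z = 0}.encard = (h.num.natDegree : ℕ∞) := by
    rw [encard_setOf_isRoot (sub_C_mul_ne_zero hW w), natDegree_sub_C_mul hdeg]
    intro z hz
    have hQ : h.denom.eval z ≠ 0 := by
      intro hQ
      refine eval_ne_zero_of_isCoprime h.isCoprime_num_denom hQ ?_
      simpa [hQ] using hz
    rw [rootMultiplicity_sub_C_mul hW hQ hz, rootMultiplicity_eq_zero]
    exact fun hz' => hwW ⟨z, hz', value_coe_eq_coe_iff.2 hz⟩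
  obtain ⟨s, hs⟩ := IsAlgClosed.exists_pow_nat_eq ((cubic lam).eval w) two_pos
  have hs0 : s ≠ 0 := by
    rintro rfl
    rw [eval_cubic, eq_comm, zero_pow two_ne_zero, mul_eq_zero, mul_eq_zero] at hs
    refine hw4 ?_
    simp only [fourPoints, Set.mem_insert_iff, Set.mem_singleton_iff, OnePoint.coe_eq_coe]
    rcases hs with (hs | hs) | hs
    · exact Or.inl hs
    · exact Or.inr (Or.inl (sub_eq_zero.1 hs))
    · exact Or.inr (Or.inr (Or.inl (sub_eq_zero.1 hs)))
  set R : Curve lam := .some w s ((nonsingular_iff h0 h1).2 hs) with hR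
  set R' : Curve lam := .some w (-s) ((nonsingular_iff h0 h1).2 ((neg_sq s).trans hs)) with hR'
  have hRR' : R ≠ R' := by
    intro e
    simp only [hR, hR', WeierstrassCurve.Affine.Point.some.injEq, true_and] at e
    have : (2 : ℂ) * s = 0 := by linear_combination e
    exact hs0 ((mul_eq_zero.1 this).resolve_left two_ne_zero)
  have hfib {Q : Curve lam} (hQ : xMap Q = (w : OnePoint ℂ)) : (f ⁻¹' {Q}).encard = (D : ℕ∞) := by
    by_contra hne
    exact hwE ⟨Q, hne, hQ⟩
  have hset : {P : Curve lam | ∃ z ∈ {z | (h.num - C w * h.denom).eval z = 0},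
      xMap P = (z : OnePoint ℂ)} = f ⁻¹' {R} ∪ f ⁻¹' {R'} := by
    ext P
    have e : P ∈ f ⁻¹' {R} ∪ f ⁻¹' {R'} ↔ value h (xMap P) = (w : OnePoint ℂ) := by
      rw [← hh P, xMap_eq_coe_iff h0 h1 hs]
      rfl
    rw [e]
    constructor
    · rintro ⟨z, hz, hP⟩
      rw [hP]
      exact value_coe_eq_coe_iff.2 hz
    · intro hP
      rcases P with _ | ⟨x, y, hxy⟩
      · exact absurd ((value_infty hdeg).symm.trans hP) (OnePoint.infty_ne_coe w)
      · exact ⟨x, value_coe_eq_coe_iff.1 hP, rfl⟩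
  have hcount := encard_xMap_preimage h0 h1 (S := {z | (h.num - C w * h.denom).eval z = 0})
    (fun z hz hz' => hw4 (value_coe_eq_coe_iff.2 hz ▸ hc z hz'))
  rw [hset, Set.encard_union_eq, hfib rfl, hfib rfl, hcard] at hcount
  · have : D + D = h.num.natDegree + h.num.natDegree := by exact_mod_cast hcount
    omega
  · exact Disjoint.preimage f (Set.disjoint_singleton.2 hRR')

theorem exists_branchForm_mul_cubic_eq_sq {lam : ℂ} {h g : RatFunc ℂ}
    (hg : g ^ 2 * cubicRat lam = h * (h - 1) * (h - RatFunc.C lam)) :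
    ∃ T : ℂ[X], branchForm lam h.num h.denom * cubic lam = T ^ 2 := by
  refine exists_eq_sq_of_algebraMap_eq_sq
    (Z := g * cubicRat lam * algebraMap ℂ[X] (RatFunc ℂ) h.denom ^ 2) ?_
  rw [map_mul, algebraMap_branchForm, ← hg]
  ring

end Legendre

end

theorem proposition2p3 (lam : ℂ) (hlam0 : lam ≠ 0) (hlam1 : lam ≠ 1)
    (D : ℕ) (hD : 0 < D)
    (f : Legendre.Curve lam → Legendre.Curve lam)
    (hf : Legendre.IsMorphism f) (hf0 : f 0 = 0) (hfD : Legendre.HasDegree f D) :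
    (∃! h : RatFunc ℂ, Legendre.Induces f h) ∧
    ∀ h : RatFunc ℂ, Legendre.Induces f h →
      Legendre.degree h = D ∧
      Legendre.value h OnePoint.infty = OnePoint.infty ∧
      (∀ p : OnePoint ℂ, Legendre.IsCriticalPoint h p → Legendre.multiplicity h p = 2) ∧
      {p : OnePoint ℂ | Legendre.IsCriticalPoint h p}.encard = ((2 * D - 2 : ℕ) : ℕ∞) ∧
      (∀ w : OnePoint ℂ, Legendre.IsCriticalValue h w → w ∈ Legendre.fourPoints lam) ∧
      (∀ p ∈ Legendre.fourPoints lam,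
        Legendre.IsSimplePoint h p ∧ Legendre.value h p ∈ Legendre.fourPoints lam) := by
  open Legendre Polynomial in
  obtain ⟨h, g, hg, hdeg, hh⟩ := exists_induces hlam0 hlam1 hD hfD hf hf0
  refine ⟨⟨h, hh, fun k hk => eq_of_induces hlam0 hlam1 hk hh⟩, fun k hk => ?_⟩
  obtain rfl : k = h := eq_of_induces hlam0 hlam1 hk hh
  obtain ⟨T, hT⟩ := exists_branchForm_mul_cubic_eq_sq hg
  have hcop := k.isCoprime_num_denom
  obtain ⟨hnd, hWdeg, c, hc, hcW⟩ := wronskian_sq_mul_cubic hlam0 hlam1 hcop hdeg hT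
  have hW := wronskian_ne_zero_of_natDegree_lt hcop hdeg
  have hsum {z : ℂ} := rootMultiplicity_wronskian_add_cubic hlam0 hlam1 hcop hW hc hcW (z := z)
  have hcubic (z : ℂ) (hz : (cubic lam).eval z = 0) :=
    eval_branchForm_eq_zero hc hcW (Or.inr hz)
  have hnum : k.num.natDegree = D := natDegree_num_eq hlam0 hlam1 hfD hh hdeg
    fun z hz => value_coe_mem_fourPoints (hcubic z hz)
  have hinf : multiplicity k OnePoint.infty = 1 := by
    rw [multiplicity_infty hdeg]
    omega
  have hroot {z : ℂ} (hz : (wronskian k.num k.denom).eval z = 0) :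
      (wronskian k.num k.denom).rootMultiplicity z = 1 := by
    have h1 := hsum (eval_branchForm_eq_zero hc hcW (Or.inl hz))
    have h2 := (rootMultiplicity_pos hW).2 hz
    omega
  have hcrit (p : OnePoint ℂ) : IsCriticalPoint k p ↔
      ∃ z : ℂ, (wronskian k.num k.denom).eval z = 0 ∧ (z : OnePoint ℂ) = p := by
    induction p using OnePoint.rec with
    | infty => simp [IsCriticalPoint, hinf]
    | coe z =>
      simp only [OnePoint.coe_eq_coe, exists_eq_right]
      rw [IsCriticalPoint, multiplicity_coe hW, Nat.lt_add_left_iff_pos, rootMultiplicity_pos hW]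
      rfl
  refine ⟨(degree_eq hdeg).trans hnum, value_infty hdeg, ?_, ?_, ?_, ?_⟩
  · intro p hp
    obtain ⟨z, hz, rfl⟩ := (hcrit p).1 hp
    rw [multiplicity_coe hW, hroot hz]
  · have hset : {p : OnePoint ℂ | IsCriticalPoint k p} =
        (fun z : ℂ => (z : OnePoint ℂ)) '' {z | (wronskian k.num k.denom).eval z = 0} := by
      ext p
      exact hcrit p
    rw [hset, OnePoint.coe_injective.encard_image, encard_setOf_isRoot hW fun z => hroot, hWdeg,
      hnum]
  · rintro w ⟨p, hp, rfl⟩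
    obtain ⟨z, hz, rfl⟩ := (hcrit p).1 hp
    exact value_coe_mem_fourPoints (eval_branchForm_eq_zero hc hcW (Or.inl hz))
  · have key (z : ℂ) (hz : (cubic lam).eval z = 0) :
        IsSimplePoint k z ∧ value k z ∈ fourPoints lam := by
      refine ⟨?_, value_coe_mem_fourPoints (hcubic z hz)⟩
      have h1 := hsum (hcubic z hz)
      have h2 := (rootMultiplicity_pos (cubic_monic lam).ne_zero).2 hz
      rw [IsSimplePoint, multiplicity_coe hW]
      omega
    rintro p (rfl | rfl | rfl | rfl)
    · exact key 0 (by simp [eval_cubic])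
    · exact key 1 (by simp [eval_cubic])
    · exact key lam (by simp [eval_cubic])
    · exact ⟨hinf, by rw [value_infty hdeg]; simp [fourPoints]⟩
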